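/- For each $d\ge 1$, consider at a fixed observation $x$ and fixed parameters $\theta,\phi$ (all of which may depend on $d$) a latent variable model with latent variable $z\in\mathbb R^d$: a nonnegative measurable function $z\mapsto p_\theta(x,z)$ with $0<p_\theta(x):=\int p_\theta(x,z)\,\mathrm dz<\infty$, and a probability density $q_\phi(\cdot|x)$ on $\mathbb R^d$. Write $w(z)=p_\theta(x,z)/q_\phi(z|x)$ and $\overline w(z)=w(z)/p_\theta(x)$. For $\alpha\in[0,1)$ and $N\ge 1$ let $$\Delta^{(\alpha)}_{N,d}=\frac1{1-\alpha}\int\!\!\int\prod_{i=1}^N q_\phi(z_i|x)\,\log\Big(\frac1N\sum_{j=1}^N w(z_j)^{1-\alpha}\Big)\,\mathrm dz_{1:N}-\log p_\theta(x)$$ be the variational gap, i.e. the difference between the VR-IWAE bound and the marginal log-likelihood. Let $z_1,\dots,z_N$ be i.i.d. with density $q_\phi(\cdot|x)$ and $\overline w_i=\overline w(z_i)$. Assume that there are i.i.d. standard normal random variables $S_1,\dots,S_N$ such that, almost surely, $$\log\overline w_i=-\frac{B_d^2}{2}-B_dS_i,\qquad i=1,\dots,N,$$ where $(B_d)_{d\ge1}$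 are real numbers for which there exists $\sigma_->0$ with $B_d\ge\sigma_-\sqrt d$ for all $d\ge1$. Then for all $\alpha\in[0,1)$, $$\lim_{\substack{N,d\to\infty\\ \log N/d\to0}}\ \Delta^{(\alpha)}_{N,d}+\frac{B_d^2}{2}\left\{1-2\,\frac{\sqrt{2\log N}}{B_d}+\frac1{1-\alpha}\,\frac{2\log N}{B_d^2}+O\!\left(\frac{\log\log N}{B_d\sqrt{\log N}}\right)\right\}=0,$$ that is, there is a function $r(N,d)$ which is $O\big(\log\log N/(B_d\sqrt{\log N})\big)$ as $N,d\to\infty$ with $\log N/d\to0$, such that the expression with $r(N,d)$ in place of the $O(\cdot)$ term tends to $0$ as $N,d\to\infty$ with $\log N/d\to 0$. -/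

import Mathlib

open MeasureTheory ProbabilityTheory Filter Topology Asymptotics

/-- A latent variable model with latent space `ℝ^d` and a variational encoder, at fixed parameters
`θ`, `φ` and at a fixed observation `x`: `joint z` is `p_θ(x, z)` and `enc z` is `q_φ(z | x)`. -/
structure LatentModel (d : ℕ) where
  /-- `z ↦ p_θ(x, z)` -/
  joint : EuclideanSpace ℝ (Fin d) → ℝ
  /-- `z ↦ q_φ(z | x)` -/
  enc : EuclideanSpace ℝ (Fin d) → ℝ
  measurable_joint : Measurable joint
  measurable_enc : Measurable enc
  joint_nonneg : ∀ z, 0 ≤ joint z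
  enc_nonneg : ∀ z, 0 ≤ enc z
  /-- `q_φ(· | x)` is a probability density. -/
  integral_enc : ∫ z, enc z = 1
  /-- `p_θ(x) < ∞` -/
  integrable_joint : Integrable joint
  /-- `0 < p_θ(x)` -/
  evidence_pos : 0 < ∫ z, joint z

namespace LatentModel

variable {d : ℕ}

/-- The marginal likelihood `p_θ(x) = ∫ p_θ(x, z) dz`. -/
noncomputable def evidence (M : LatentModel d) : ℝ := ∫ z, M.joint z

/-- The marginal log-likelihood `ℓ_d(θ; x) = log p_θ(x)`. -/
noncomputable def logLik (M : LatentModel d) : ℝ := Real.log M.evidence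

/-- The unnormalized weight `w(z) = p_θ(x, z) / q_φ(z | x)`. -/
noncomputable def weight (M : LatentModel d) (z : EuclideanSpace ℝ (Fin d)) : ℝ :=
  M.joint z / M.enc z

/-- The relative weight `w(z) / p_θ(x)`. -/
noncomputable def relWeight (M : LatentModel d) (z : EuclideanSpace ℝ (Fin d)) : ℝ :=
  M.weight z / M.evidence

/-- The probability measure on `ℝ^d` with density `q_φ(· | x)`. -/
noncomputable def encMeasure (M : LatentModel d) : Measure (EuclideanSpace ℝ (Fin d)) :=
  volume.withDensity fun z => ENNReal.ofReal (M.enc z)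

/-- The joint law of `N` i.i.d. samples `z_1, …, z_N` from `q_φ(· | x)`. -/
noncomputable def sampleMeasure (M : LatentModel d) (N : ℕ) :
    Measure (Fin N → EuclideanSpace ℝ (Fin d)) :=
  Measure.pi fun _ => M.encMeasure

/-- The VR-IWAE bound
`1/(1-α) ∫∫ ∏ᵢ q_φ(zᵢ | x) log ((1/N) ∑ⱼ w(zⱼ)^(1-α)) dz_1 … dz_N`. -/
noncomputable def vrIwae (M : LatentModel d) (α : ℝ) (N : ℕ) : ℝ :=
  1 / (1 - α) * ∫ z : Fin N → EuclideanSpace ℝ (Fin d),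
    (∏ i, M.enc (z i)) * Real.log (1 / (N : ℝ) * ∑ j, M.weight (z j) ^ (1 - α))

/-- The variational gap: the VR-IWAE bound minus the marginal log-likelihood. -/
noncomputable def gap (M : LatentModel d) (α : ℝ) (N : ℕ) : ℝ :=
  M.vrIwae α N - M.logLik

end LatentModel

/-- The regime `N → ∞`, `d → ∞`, `log N / d → 0`, as a filter on the pairs `(N, d)`. -/
noncomputable def subexpRegime : Filter (ℕ × ℕ) :=
  (atTop ×ˢ atTop) ⊓ comap (fun p : ℕ × ℕ => Real.log (p.1 : ℝ) / (p.2 : ℝ)) (𝓝 0)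

/-! ### Log-sum-exp: elementary bounds and integrability. -/

section LogSumExp

variable {ι Ω : Type*} [Fintype ι] [MeasurableSpace Ω] {P : Measure Ω}

/-! With `X i = -S i`, `gap_eq_of_lognormal` writes the gap as `-B²/2 - log N/(1-α)` plus `1/(1-α)`
times the expected log-sum-exp of `a * X i`, where `a = (1-α) B`. The theorem thus says that this
expectation is `a √(2 log N)` up to an error `O(a log log N / √(log N))`.

Above (`integral_log_sum_exp_le`): `(1/β) log ∑ exp (β x i)` decreases in `β`, so `a` may be lowered
to `√(2 log N)`, where Jensen gives exactly `a √(2 log N)`. This needs `√(2 log N) ≤ a`, which `log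
N / d → 0` and `B ≥ σ √d` ensure eventually.

Below (`integral_log_sum_exp_ge`): log-sum-exp dominates `a` times the maximum, and by the Gaussian
tail bound and independence the maximum exceeds `√(2 log N) - O(log log N / √(log N))` with high
probability.

Dividing the defect by `-B²/2` then gives a remainder `r` for which the expression eventually
vanishes. -/

lemma exp_sum_pos [Nonempty ι] (x : ι → ℝ) : 0 < ∑ i, Real.exp (x i) :=
  Finset.sum_pos (fun _ _ => Real.exp_pos _) Finset.univ_nonempty

lemma le_log_sum_exp (x : ι → ℝ) (i : ι) : x i ≤ Real.log (∑ j, Real.exp (x j)) := by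
  have h : Real.exp (x i) ≤ ∑ j, Real.exp (x j) :=
    Finset.single_le_sum (f := fun j => Real.exp (x j)) (fun j _ => (Real.exp_pos _).le)
      (Finset.mem_univ i)
  exact (Real.le_log_iff_exp_le ((Real.exp_pos _).trans_le h)).2 h

lemma abs_log_sum_exp_le [Nonempty ι] (x : ι → ℝ) :
    |Real.log (∑ j, Real.exp (x j))| ≤ Real.log (Fintype.card ι) + ∑ j, |x j| := by
  have hx : ∀ i, |x i| ≤ ∑ j, |x j| := fun i =>
    Finset.single_le_sum (f := fun j => |x j|) (fun j _ => abs_nonneg _) (Finset.mem_univ i)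
  have hcard : (1 : ℝ) ≤ Fintype.card ι := by exact_mod_cast Fintype.card_pos (α := ι)
  rw [abs_le]
  constructor
  · have i : ι := Classical.arbitrary ι
    have h1 := le_log_sum_exp x i
    have h2 := neg_abs_le (x i)
    have h3 := Real.log_nonneg hcard
    linarith [hx i]
  · rw [Real.log_le_iff_le_exp (exp_sum_pos x), Real.exp_add, Real.exp_log (by linarith)]
    calc ∑ j, Real.exp (x j) ≤ ∑ _j : ι, Real.exp (∑ j, |x j|) :=
          Finset.sum_le_sum fun i _ => Real.exp_le_exp.2 ((le_abs_self _).trans (hx i))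
      _ = _ := by simp

lemma integrable_log_sum_exp [IsFiniteMeasure P] [Nonempty ι] {X : ι → Ω → ℝ}
    (hX : ∀ i, Integrable (X i) P) :
    Integrable (fun ω => Real.log (∑ i, Real.exp (X i ω))) P := by
  refine Integrable.mono' (g := fun ω => Real.log (Fintype.card ι) + ∑ j, |X j ω|)
    ((integrable_const _).add (integrable_finsetSum _ fun i _ => (hX i).abs)) ?_
    (ae_of_all _ fun ω => abs_log_sum_exp_le _)
  have : AEMeasurable (fun ω => Real.log (∑ i, Real.exp (X i ω))) P := by
    have := fun i => (hX i).aemeasurable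
    fun_prop
  exact this.aestronglyMeasurable

end LogSumExp

lemma ProbabilityTheory.HasLaw.integrable_of_gaussianReal {Ω : Type*} [MeasurableSpace Ω]
    {P : Measure Ω} {X : Ω → ℝ} {m : ℝ} {v : NNReal} (hX : HasLaw X (gaussianReal m v) P) :
    Integrable X P := by
  have h : Integrable (fun x : ℝ => x) (gaussianReal m v) :=
    memLp_one_iff_integrable.1 (memLp_id_gaussianReal' 1 (by simp))
  rw [← hX.map_eq] at h
  exact (integrable_map_measure aestronglyMeasurable_id hX.aemeasurable).1 h

/-! ### Reduction of the variational gap to Gaussian variables. -/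

namespace LatentModel

variable {d : ℕ} (M : LatentModel d)

lemma integrable_enc : Integrable M.enc := by
  by_contra h
  -- The integral of a non-integrable function is `0` by convention, which contradicts the value
  -- `1`.
  simpa [integral_undef h] using M.integral_enc

instance : IsProbabilityMeasure M.encMeasure := by
  refine ⟨?_⟩
  rw [encMeasure, withDensity_apply _ MeasurableSet.univ, Measure.restrict_univ,
    ← ofReal_integral_eq_lintegral_ofReal M.integrable_enc (ae_of_all _ M.enc_nonneg),
    M.integral_enc, ENNReal.ofReal_one]

instance (N : ℕ) : IsProbabilityMeasure (M.sampleMeasure N) := by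
  unfold sampleMeasure; infer_instance

lemma sampleMeasure_eq_withDensity (N : ℕ) :
    M.sampleMeasure N = volume.withDensity fun z => ENNReal.ofReal (∏ i, M.enc (z i)) := by
  refine Measure.pi_eq fun s hs => ?_
  have hint : ∀ i, IntegrableOn M.enc (s i) := fun i => M.integrable_enc.integrableOn
  rw [withDensity_apply _ (MeasurableSet.univ_pi hs), volume_pi, Measure.restrict_pi_pi,
    ← ofReal_integral_eq_lintegral_ofReal (Integrable.fintype_prod hint)
      (ae_of_all _ fun z => Finset.prod_nonneg fun i _ => M.enc_nonneg _),
    integral_fintype_prod_eq_prod (fun _ => M.enc),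
    ENNReal.ofReal_prod_of_nonneg fun i _ => integral_nonneg M.enc_nonneg]
  refine Finset.prod_congr rfl fun i _ => ?_
  rw [encMeasure, withDensity_apply _ (hs i),
    ofReal_integral_eq_lintegral_ofReal (hint i) (ae_of_all _ M.enc_nonneg)]

lemma integral_sampleMeasure (N : ℕ) (f : (Fin N → EuclideanSpace ℝ (Fin d)) → ℝ) :
    ∫ z, f z ∂(M.sampleMeasure N) = ∫ z, (∏ i, M.enc (z i)) * f z := by
  have hm := M.measurable_enc
  rw [sampleMeasure_eq_withDensity, integral_withDensity_eq_integral_toReal_smul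
    (by fun_prop) (ae_of_all _ fun _ => ENNReal.ofReal_lt_top)]
  refine integral_congr_ae (ae_of_all _ fun z => ?_)
  simp only [smul_eq_mul]
  rw [ENNReal.toReal_ofReal (Finset.prod_nonneg fun i _ => M.enc_nonneg _)]

lemma relWeight_nonneg (z : EuclideanSpace ℝ (Fin d)) : 0 ≤ M.relWeight z :=
  div_nonneg (div_nonneg (M.joint_nonneg z) (M.enc_nonneg z)) M.evidence_pos.le

lemma weight_eq (z : EuclideanSpace ℝ (Fin d)) : M.weight z = M.evidence * M.relWeight z := by
  have : M.evidence ≠ 0 := M.evidence_pos.ne'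
  rw [relWeight]; field_simp

/-- In the log-normal case the variational gap is an expected log-sum-exp of Gaussians. -/
lemma gap_eq_of_lognormal {N : ℕ} (hN : 1 ≤ N) {b α : ℝ} (hb : b ≠ 0) (hα : α < 1)
    {S : Fin N → (Fin N → EuclideanSpace ℝ (Fin d)) → ℝ}
    (hS : ∀ i, HasLaw (S i) (gaussianReal 0 1) (M.sampleMeasure N))
    (hw : ∀ i, ∀ᵐ z ∂(M.sampleMeasure N),
      Real.log (M.relWeight (z i)) = -b ^ 2 / 2 - b * S i z) :
    M.gap α N = -b ^ 2 / 2 - Real.log N / (1 - α) + 1 / (1 - α) *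
      ∫ z, Real.log (∑ i, Real.exp ((1 - α) * b * -S i z)) ∂(M.sampleMeasure N) := by
  have hα' : 0 < 1 - α := by linarith
  have hev : 0 < M.evidence := M.evidence_pos
  have hN' : (0 : ℝ) < N := by exact_mod_cast hN
  have : Nonempty (Fin N) := ⟨⟨0, hN⟩⟩
  -- Since `Real.log 0 = 0`, the log-normal identity allows a zero weight, but only where `S i =
  -- -b/2`, a null event.
  have hne : ∀ i, ∀ᵐ z ∂(M.sampleMeasure N), S i z ≠ -b / 2 := fun i => by
    have := nullSingletonClass_gaussianReal (μ := 0) (v := 1) one_ne_zero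
    rw [(hS i).ae_iff (p := fun x => x ≠ -b / 2) (by
      exact (measurableSet_singleton _).compl.mem)]
    exact Measure.ae_ne _ _
  have hpt : ∀ᵐ z ∂(M.sampleMeasure N),
      Real.log (1 / (N : ℝ) * ∑ j, M.weight (z j) ^ (1 - α)) =
        ((1 - α) * (M.logLik - b ^ 2 / 2) - Real.log N) +
          Real.log (∑ i, Real.exp ((1 - α) * b * -S i z)) := by
    filter_upwards [ae_all_iff.2 hw, ae_all_iff.2 hne] with z h1 h2
    have hpos : ∀ i, 0 < M.relWeight (z i) := fun i => by
      refine (M.relWeight_nonneg _).lt_of_ne fun h0 => h2 i ?_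
      have h3 := h1 i
      rw [← h0, Real.log_zero] at h3
      have h4 : b * (S i z + b / 2) = 0 := by linear_combination h3
      rcases mul_eq_zero.1 h4 with h | h
      · exact absurd h hb
      · linear_combination h
    have hwt : ∀ i, M.weight (z i) ^ (1 - α) =
        Real.exp ((1 - α) * (M.logLik - b ^ 2 / 2)) * Real.exp ((1 - α) * b * -S i z) := by
      intro i
      rw [M.weight_eq, Real.rpow_def_of_pos (mul_pos hev (hpos i)),
        Real.log_mul hev.ne' (hpos i).ne', h1 i, ← Real.exp_add]
      congr 1
      simp only [logLik]
      ring
    simp_rw [hwt]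
    rw [← Finset.mul_sum, Real.log_mul (by positivity)
      (mul_pos (Real.exp_pos _) (exp_sum_pos _)).ne',
      Real.log_mul (Real.exp_pos _).ne' (exp_sum_pos _).ne', Real.log_exp, one_div, Real.log_inv]
    ring
  have hint : Integrable (fun z => Real.log (∑ i, Real.exp ((1 - α) * b * -S i z)))
      (M.sampleMeasure N) :=
    integrable_log_sum_exp fun i => ((hS i).integrable_of_gaussianReal.neg).const_mul _
  rw [gap, vrIwae, ← M.integral_sampleMeasure N fun z =>
    Real.log (1 / (N : ℝ) * ∑ j, M.weight (z j) ^ (1 - α)), integral_congr_ae hpt,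
    integral_add (integrable_const _) hint, integral_const, probReal_univ, one_smul]
  field_simp
  ring

end LatentModel

/-! ### Gaussian tails. -/

lemma Real.log_sq_le_self {x : ℝ} (hx : 1 ≤ x) : Real.log x ^ 2 ≤ x := by
  have h0 := Real.log_nonneg hx
  have h1 := Real.quadratic_le_exp_of_nonneg (x := Real.log x / 2) (by linarith)
  have h2 : Real.exp (Real.log x / 2) ^ 2 = x := by
    rw [← Real.exp_nat_mul]; push_cast
    rw [mul_div_cancel₀ _ two_ne_zero, Real.exp_log (by linarith)]
  have h3 : Real.log x ≤ Real.exp (Real.log x / 2) := by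
    nlinarith [sq_nonneg (Real.log x / 2 - 1)]
  nlinarith

/-- A lower bound for the Gaussian tail. -/
lemma gaussianReal_Ici_ge {t : ℝ} (ht : 1 ≤ t) :
    (√(2 * Real.pi))⁻¹ * Real.exp (-3 / 2) * (Real.exp (-t ^ 2 / 2) / t) ≤
      (gaussianReal 0 1).real (Set.Ici t) := by
  have ht0 : 0 < t := by linarith
  set c := (√(2 * Real.pi))⁻¹ * Real.exp (-3 / 2) * Real.exp (-t ^ 2 / 2) with hc
  -- On an interval of length `1/t` the exponent `x²/2` grows by at most `3/2`, so the density loses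
  -- only a constant factor.
  have hpdf : ∀ x ∈ Set.Icc t (t + 1 / t), c ≤ gaussianPDFReal 0 1 x := by
    intro x hx
    rw [gaussianPDFReal_def, hc]
    simp only [NNReal.coe_one, mul_one, sub_zero]
    rw [mul_assoc, ← Real.exp_add]
    refine mul_le_mul_of_nonneg_left (Real.exp_le_exp.2 ?_) (by positivity)
    have h1 : x ^ 2 ≤ (t + 1 / t) ^ 2 := pow_le_pow_left₀ (by linarith [hx.1]) hx.2 2
    have h2 : (t + 1 / t) ^ 2 = t ^ 2 + 2 + (1 / t) ^ 2 := by field_simp; ring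
    have h3 : 1 / t ≤ 1 := by rw [div_le_one ht0]; exact ht
    have h4 : (1 / t) ^ 2 ≤ 1 := pow_le_one₀ (by positivity) h3
    linarith
  have hint := integrable_gaussianPDFReal 0 1
  have h1 : (gaussianReal 0 1).real (Set.Icc t (t + 1 / t)) =
      ∫ x in Set.Icc t (t + 1 / t), gaussianPDFReal 0 1 x := by
    rw [Measure.real, gaussianReal_apply_eq_integral 0 one_ne_zero, ENNReal.toReal_ofReal]
    exact integral_nonneg fun x => gaussianPDFReal_nonneg 0 1 x
  calc _ = ∫ x in Set.Icc t (t + 1 / t), c := by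
        rw [setIntegral_const, Real.volume_real_Icc_of_le (by simp [ht0.le]), smul_eq_mul]
        rw [hc]; field_simp; ring
    _ ≤ ∫ x in Set.Icc t (t + 1 / t), gaussianPDFReal 0 1 x :=
        setIntegral_mono_on (by simp) hint.integrableOn measurableSet_Icc hpdf
    _ ≤ _ := by
        rw [← h1]; exact measureReal_mono Set.Icc_subset_Ici_self

/-! ### Two-sided bounds for the expected log-sum-exp of Gaussians. -/

section

variable {ι Ω : Type*} [Fintype ι] [MeasurableSpace Ω] {P : Measure Ω} {X : ι → Ω → ℝ}

/-- This is the monotonicity of `ℓ^p` norms in `p`: each `b * x i` is at most the log-sum-exp `l`,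
so raising the scale from `b` to `a` costs each term a factor of at most `exp ((a/b - 1) l)`. -/
lemma log_sum_exp_mul_le [Nonempty ι] (x : ι → ℝ) {a b : ℝ} (hb : 0 < b) (hab : b ≤ a) :
    Real.log (∑ i, Real.exp (a * x i)) ≤ a / b * Real.log (∑ i, Real.exp (b * x i)) := by
  set l := Real.log (∑ i, Real.exp (b * x i)) with hl
  have hY := exp_sum_pos fun i => b * x i
  rw [Real.log_le_iff_le_exp (exp_sum_pos _)]
  have key : ∀ i, Real.exp (a * x i) ≤ Real.exp (b * x i) * Real.exp ((a / b - 1) * l) := by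
    intro i
    rw [← Real.exp_add, Real.exp_le_exp]
    have h1 : b * x i ≤ l := le_log_sum_exp (fun i => b * x i) i
    have h2 : 0 ≤ a / b - 1 := by rw [sub_nonneg, one_le_div hb]; exact hab
    have h3 : a * x i = b * x i + (a / b - 1) * (b * x i) := by field_simp; ring
    rw [h3]
    exact add_le_add_right (mul_le_mul_of_nonneg_left h1 h2) _
  calc _ ≤ ∑ i, Real.exp (b * x i) * Real.exp ((a / b - 1) * l) :=
        Finset.sum_le_sum fun i _ => key i
    _ = Real.exp l * Real.exp ((a / b - 1) * l) := by
        rw [← Finset.sum_mul, hl, Real.exp_log hY]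
    _ = _ := by rw [← Real.exp_add]; congr 1; ring

/-- The expected log-sum-exp of standard Gaussians is at most the first-order value of the scaled
maximum, at large scales. -/
lemma integral_log_sum_exp_le [Nontrivial ι] [IsProbabilityMeasure P]
    (hX : ∀ i, HasLaw (X i) (gaussianReal 0 1) P) {a : ℝ}
    (ha : √(2 * Real.log (Fintype.card ι)) ≤ a) :
    ∫ ω, Real.log (∑ i, Real.exp (a * X i ω)) ∂P ≤ a * √(2 * Real.log (Fintype.card ι)) := by
  set n : ℝ := (Fintype.card ι : ℝ) with hn
  set b := √(2 * Real.log n) with hb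
  have hn1 : 1 < n := by rw [hn]; exact_mod_cast Fintype.one_lt_card (α := ι)
  have hlog : 0 < Real.log n := Real.log_pos hn1
  have hb0 : 0 < b := Real.sqrt_pos.2 (by linarith)
  have hb2 : b ^ 2 = 2 * Real.log n := Real.sq_sqrt (by linarith)
  -- `m` is the mean of `∑ exp (b * X i)`; the tangent line of `log` at `m` yields Jensen's
  -- inequality. The choice of `b` makes `log m = b²`.
  set m := n * Real.exp (b ^ 2 / 2) with hm
  have hm0 : 0 < m := by positivity
  have hlm : Real.log m = b ^ 2 := by
    rw [hm, Real.log_mul (by positivity) (Real.exp_pos _).ne', Real.log_exp]; linarith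
  have hexp : ∀ i, Integrable (fun ω => Real.exp (b * X i ω)) P := fun i => by
    have h := integrable_exp_mul_gaussianReal (μ := 0) (v := 1) b
    rw [← (hX i).map_eq] at h
    exact (integrable_map_measure (by fun_prop) (hX i).aemeasurable).1 h
  have hval : ∀ i, ∫ ω, Real.exp (b * X i ω) ∂P = Real.exp (b ^ 2 / 2) := fun i => by
    have h := mgf_gaussianReal (hX i).map_eq b
    rw [mgf] at h
    rw [h]; simp
  have hpt : ∀ ω, Real.log (∑ i, Real.exp (a * X i ω)) ≤
      a / b * (b ^ 2 - 1 + (∑ i, Real.exp (b * X i ω)) / m) := by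
    intro ω
    refine (log_sum_exp_mul_le _ hb0 ha).trans ?_
    refine mul_le_mul_of_nonneg_left ?_ (div_nonneg (hb0.le.trans ha) hb0.le)
    have hY := exp_sum_pos fun i => b * X i ω
    have h := Real.log_le_sub_one_of_pos (div_pos hY hm0)
    rw [Real.log_div hY.ne' hm0.ne', hlm] at h
    linarith
  have hsum : Integrable (fun ω => (∑ i, Real.exp (b * X i ω)) / m) P :=
    (integrable_finsetSum _ fun i _ => hexp i).div_const _
  calc _ ≤ ∫ ω, a / b * (b ^ 2 - 1 + (∑ i, Real.exp (b * X i ω)) / m) ∂P := by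
        refine integral_mono (integrable_log_sum_exp fun i =>
          (hX i).integrable_of_gaussianReal.const_mul _) ?_ hpt
        exact ((integrable_const _).add hsum).const_mul _
    _ = a / b * (b ^ 2 - 1 + 1) := by
        rw [integral_const_mul, integral_add (integrable_const _) hsum, integral_const,
          integral_div, integral_finsetSum _ fun i _ => hexp i]
        simp_rw [hval]
        rw [Finset.sum_const, Finset.card_univ, nsmul_eq_mul, ← hn, ← hm, div_self hm0.ne']
        simp
    _ = _ := by field_simp; ring

/-- All of `n` independent standard Gaussians lie below `t` with small probability. -/
lemma measureReal_forall_lt_le [Nonempty ι] [IsProbabilityMeasure P]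
    (hX : ∀ i, HasLaw (X i) (gaussianReal 0 1) P) (hind : iIndepFun X P) (t : ℝ)
    (hq : 0 < (gaussianReal 0 1).real (Set.Ici t)) :
    P.real {ω | ∀ i, X i ω < t} ≤
      (Fintype.card ι * (gaussianReal 0 1).real (Set.Ici t))⁻¹ := by
  set q := (gaussianReal 0 1).real (Set.Ici t) with hqdef
  have hset : {ω | ∀ i, X i ω < t} = ⋂ i ∈ Finset.univ, X i ⁻¹' Set.Iio t := by
    ext ω; simp
  have h1 : ∀ i, P.real (X i ⁻¹' Set.Iio t) = 1 - q := fun i => by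
    have := (hX i).measureReal_eq (p := fun x => x < t) measurableSet_Iio
    rw [hqdef, ← probReal_compl_eq_one_sub measurableSet_Ici, Set.compl_Ici]
    exact this
  have h2 : P.real {ω | ∀ i, X i ω < t} = (1 - q) ^ Fintype.card ι := by
    rw [hset, Measure.real, hind.measure_inter_preimage_eq_mul _ fun i _ => measurableSet_Iio,
      ENNReal.toReal_prod]
    refine (Finset.prod_congr rfl fun i _ => h1 i).trans ?_
    simp
  have hq1 : q ≤ 1 := measureReal_le_one
  have hn : (0 : ℝ) < Fintype.card ι := by exact_mod_cast Fintype.card_pos (α := ι)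
  rw [h2]
  calc (1 - q) ^ Fintype.card ι ≤ Real.exp (-q) ^ Fintype.card ι :=
        pow_le_pow_left₀ (by linarith) (by linarith [Real.add_one_le_exp (-q)]) _
    _ = (Real.exp (Fintype.card ι * q))⁻¹ := by
        rw [← Real.exp_nat_mul, ← Real.exp_neg]; congr 1; ring
    _ ≤ _ := by
        refine inv_anti₀ (by positivity) ?_
        linarith [Real.add_one_le_exp (Fintype.card ι * q)]

/-- Off the event, some `X i` reaches `t`. On it, one fixed `X k` serves as lower bound through `x ≥
-ε x²/2 - 1/(2ε)`; this separates `X k` from the event, and `X k ^ 2` has mean `1`. -/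
lemma integral_log_sum_exp_ge_of_level [Nonempty ι] [IsProbabilityMeasure P]
    (hX : ∀ i, HasLaw (X i) (gaussianReal 0 1) P) {a t ε : ℝ} (ha : 0 ≤ a) (hε : 0 < ε) :
    a * (t - ε / 2 - (t + 1 / (2 * ε)) * P.real {ω | ∀ i, X i ω < t}) ≤
      ∫ ω, Real.log (∑ i, Real.exp (a * X i ω)) ∂P := by
  set A := {ω | ∀ i, X i ω < t} with hA
  have hAm : NullMeasurableSet A P := by
    have : A = ⋂ i, X i ⁻¹' Set.Iio t := by ext ω; simp [hA]
    rw [this]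
    exact NullMeasurableSet.iInter fun i =>
      (hX i).aemeasurable.nullMeasurableSet_preimage measurableSet_Iio
  obtain ⟨k⟩ := ‹Nonempty ι›
  have : Nonempty ι := ⟨k⟩
  have hind : Integrable (A.indicator fun _ => (1 : ℝ)) P :=
    (integrable_const _).indicator₀ hAm
  have hsqL : MemLp (X k) 2 P := by
    have h := memLp_id_gaussianReal' (μ := 0) (v := 1) 2 (by simp)
    rw [← (hX k).map_eq] at h
    exact (memLp_map_measure_iff aestronglyMeasurable_id (hX k).aemeasurable).1 h
  have hsq : Integrable (fun ω => X k ω ^ 2) P := hsqL.integrable_sq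
  have hsqv : ∫ ω, X k ω ^ 2 ∂P = 1 := by
    have h := (hX k).integral_comp (f := fun x => x ^ 2) (by fun_prop)
    have h2 := variance_fun_id_gaussianReal (μ := 0) (v := 1)
    rw [variance_of_integral_eq_zero (by fun_prop) integral_id_gaussianReal] at h2
    have h3 : ∫ ω, X k ω ^ 2 ∂P = ∫ x, x ^ 2 ∂gaussianReal 0 1 := h
    rw [h3]; simpa using h2
  have hpt : ∀ ω, a * (t - ε / 2 * X k ω ^ 2 -
      (t + 1 / (2 * ε)) * A.indicator (fun _ => (1 : ℝ)) ω) ≤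
        Real.log (∑ i, Real.exp (a * X i ω)) := by
    intro ω
    by_cases hω : ω ∈ A
    · refine le_trans ?_ (le_log_sum_exp (fun i => a * X i ω) k)
      refine mul_le_mul_of_nonneg_left ?_ ha
      rw [Set.indicator_of_mem hω]
      have h : 0 ≤ (ε * X k ω + 1) ^ 2 / (2 * ε) := by positivity
      have h2 : (ε * X k ω + 1) ^ 2 / (2 * ε) = ε / 2 * X k ω ^ 2 + X k ω + 1 / (2 * ε) := by
        field_simp; ring
      linarith
    · have : ∃ i, t ≤ X i ω := by simpa [hA] using hω
      obtain ⟨i, hi⟩ := this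
      refine le_trans ?_ (le_log_sum_exp (fun i => a * X i ω) i)
      refine mul_le_mul_of_nonneg_left ?_ ha
      rw [Set.indicator_of_notMem hω]
      have : 0 ≤ ε / 2 * X k ω ^ 2 := by positivity
      linarith
  have hmid : Integrable (fun ω => t - ε / 2 * X k ω ^ 2) P :=
    (integrable_const _).sub (hsq.const_mul _)
  calc _ = ∫ ω, a * (t - ε / 2 * X k ω ^ 2 -
      (t + 1 / (2 * ε)) * A.indicator (fun _ => (1 : ℝ)) ω) ∂P := by
        rw [integral_const_mul, integral_sub hmid (hind.const_mul _), integral_sub (integrable_const _) (hsq.const_mul _),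
          integral_const_mul, integral_const_mul, hsqv, integral_indicator₀ hAm]
        simp
    _ ≤ _ := by
        refine integral_mono ?_ (integrable_log_sum_exp fun i =>
          (hX i).integrable_of_gaussianReal.const_mul _) hpt
        exact (hmid.sub (hind.const_mul _)).const_mul _

end

/-- The constant `e^{-5/2} / √(2π)` in the lower bound for the expected maximum of Gaussians. -/
noncomputable def gaussianTailConst : ℝ :=
  (√(2 * Real.pi))⁻¹ * Real.exp (-3 / 2) * Real.exp (-1)

lemma gaussianTailConst_pos : 0 < gaussianTailConst := by
  unfold gaussianTailConst
  positivity

lemma integral_log_sum_exp_ge {ι Ω : Type*} [Fintype ι] [MeasurableSpace Ω] {P : Measure Ω}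
    {X : ι → Ω → ℝ} [Nonempty ι] [IsProbabilityMeasure P]
    (hX : ∀ i, HasLaw (X i) (gaussianReal 0 1) P) (hind : iIndepFun X P) {a : ℝ} (ha : 0 ≤ a)
    (hL : 8 ≤ Real.log (Fintype.card ι)) :
    a * (√(2 * Real.log (Fintype.card ι)) - (3 + 3 / gaussianTailConst) *
        (Real.log (Real.log (Fintype.card ι)) / √(Real.log (Fintype.card ι)))) ≤
      ∫ ω, Real.log (∑ i, Real.exp (a * X i ω)) ∂P := by
  have hn0 : (0 : ℝ) < Fintype.card ι := by exact_mod_cast Fintype.card_pos (α := ι)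
  have hc := gaussianTailConst_pos
  set n : ℝ := (Fintype.card ι : ℝ) with hn
  set L := Real.log n with hLdef
  set l := Real.log L with hl
  set g := √L with hg
  set b := √(2 * L) with hb
  set c := gaussianTailConst with hcdef
  have hL0 : 0 < L := by linarith
  have hg2 : g ^ 2 = L := Real.sq_sqrt hL0.le
  have hb2 : b ^ 2 = 2 * L := Real.sq_sqrt (by linarith)
  have hg0 : 0 < g := Real.sqrt_pos.2 hL0
  have hb0 : 0 < b := Real.sqrt_pos.2 (by linarith)
  have hg1 : 1 ≤ g := by nlinarith
  have hb4 : 4 ≤ b := by nlinarith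
  have hgb : g ≤ b := by nlinarith
  have hbg : b ≤ 3 / 2 * g := by nlinarith
  have hl1 : 1 ≤ l := by
    rw [hl, Real.le_log_iff_exp_le hL0]
    linarith [Real.exp_one_lt_d9]
  have hl2 : l ^ 2 ≤ L := Real.log_sq_le_self (by linarith)
  -- Chosen so that `b * s = 2 log L`: lowering the level from `b` to `b - s` gains a factor `L²` in
  -- the tail, at the cost of `exp (-s²/2) ≥ exp (-1)`. The expected number of exceedances is then
  -- at least `c L² / t`.
  set s := 2 * l / b with hs
  have hs0 : 0 < s := by positivity
  have hbs : b * s = 2 * l := by rw [hs]; field_simp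
  have hs2 : s ^ 2 ≤ 2 := by
    have : s ^ 2 = 4 * l ^ 2 / b ^ 2 := by rw [hs]; ring
    rw [this, div_le_iff₀ (by positivity)]
    linarith
  have hs2' : s ≤ 2 := by nlinarith
  set t := b - s with ht
  have ht1 : 1 ≤ t := by linarith
  have ht0 : 0 < t := by linarith
  have htb : t ≤ b := by linarith
  have hexp : n⁻¹ * L ^ 2 * Real.exp (-1) ≤ Real.exp (-t ^ 2 / 2) := by
    have h1 : n⁻¹ * L ^ 2 * Real.exp (-1) = Real.exp (-L + 2 * l + -1) := by
      rw [Real.exp_add, Real.exp_add, Real.exp_neg L, hLdef, Real.exp_log hn0, ← hLdef, mul_comm 2 l,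
        Real.exp_mul, hl, Real.exp_log hL0]
      norm_cast
    rw [h1, Real.exp_le_exp]
    nlinarith
  set q := (gaussianReal 0 1).real (Set.Ici t) with hq
  have hnq : c * L ^ 2 / t ≤ n * q := by
    have h := gaussianReal_Ici_ge ht1
    have hk : 0 < (√(2 * Real.pi))⁻¹ * Real.exp (-3 / 2) := by positivity
    calc c * L ^ 2 / t = n * ((√(2 * Real.pi))⁻¹ * Real.exp (-3 / 2) *
          (n⁻¹ * L ^ 2 * Real.exp (-1) / t)) := by
          rw [hcdef, gaussianTailConst]; field_simp
      _ ≤ n * ((√(2 * Real.pi))⁻¹ * Real.exp (-3 / 2) * (Real.exp (-t ^ 2 / 2) / t)) := by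
          gcongr
      _ ≤ n * q := mul_le_mul_of_nonneg_left h hn0.le
  have hnq0 : 0 < n * q := lt_of_lt_of_le (by positivity) hnq
  have hq0 : 0 < q := pos_of_mul_pos_right hnq0 hn0.le
  have hp : P.real {ω | ∀ i, X i ω < t} ≤ b / (c * L ^ 2) := by
    calc _ ≤ (n * q)⁻¹ := measureReal_forall_lt_le hX hind t hq0
      _ ≤ (c * L ^ 2 / t)⁻¹ := inv_anti₀ (by positivity) hnq
      _ = t / (c * L ^ 2) := inv_div _ _
      _ ≤ _ := by gcongr
  -- With `ε = 1/√L`, both the `ε/2` loss and the bad-event term, of order `√L · √L / L² = 1/L`, are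
  -- absorbed by `log L / √L`.
  refine le_trans (mul_le_mul_of_nonneg_left ?_ ha)
    (integral_log_sum_exp_ge_of_level hX (t := t) ha (inv_pos.2 hg0))
  have h1 : (t + 1 / (2 * g⁻¹)) * P.real {ω | ∀ i, X i ω < t} ≤ 3 / c * (l / g) := by
    calc _ ≤ (2 * g) * (3 / 2 * g / (c * L ^ 2)) := by
          have h2 : 1 / (2 * g⁻¹) = g / 2 := by field_simp
          rw [h2]
          refine mul_le_mul (by linarith) (hp.trans ?_) measureReal_nonneg (by positivity)
          gcongr
      _ = 3 / c * (1 / L) := by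
          rw [← hg2]; field_simp
      _ ≤ 3 / c * (l / g) := by
          refine mul_le_mul_of_nonneg_left ?_ (by positivity)
          refine div_le_div₀ (by linarith) hl1 hg0 ?_
          nlinarith
  have h2 : s ≤ 2 * (l / g) := by
    rw [hs, mul_div_assoc]
    gcongr
  have h3 : g⁻¹ ≤ l / g := by
    rw [inv_eq_one_div]
    gcongr
  have h4 : 0 < g⁻¹ := inv_pos.2 hg0
  rw [add_mul]
  linarith

/-! ### The asymptotic expansion. -/

theorem theorem5
    (M : ∀ d : ℕ, LatentModel d) (B : ℕ → ℝ)
    (σ_min : ℝ) (hσ : 0 < σ_min) (hB : ∀ d : ℕ, 1 ≤ d → σ_min * √(d : ℝ) ≤ B d)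
    (S : ∀ N d : ℕ, Fin N → (Fin N → EuclideanSpace ℝ (Fin d)) → ℝ)
    (hS_law : ∀ N d : ℕ, 1 ≤ N → 1 ≤ d → ∀ i : Fin N,
      HasLaw (S N d i) (gaussianReal 0 1) ((M d).sampleMeasure N))
    (hS_indep : ∀ N d : ℕ, 1 ≤ N → 1 ≤ d → iIndepFun (S N d) ((M d).sampleMeasure N))
    (hw : ∀ N d : ℕ, 1 ≤ N → 1 ≤ d → ∀ i : Fin N, ∀ᵐ z ∂((M d).sampleMeasure N),
      Real.log ((M d).relWeight (z i)) = -(B d) ^ 2 / 2 - B d * S N d i z)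
    (α : ℝ) (hα : α ∈ Set.Ico (0 : ℝ) 1) :
    ∃ r : ℕ × ℕ → ℝ,
      r =O[subexpRegime] (fun p : ℕ × ℕ =>
        Real.log (Real.log (p.1 : ℝ)) / (B p.2 * √(Real.log (p.1 : ℝ)))) ∧
      Tendsto (fun p : ℕ × ℕ =>
        (M p.2).gap α p.1 + (B p.2) ^ 2 / 2 *
          (1 - 2 * (√(2 * Real.log (p.1 : ℝ)) / B p.2)
            + 1 / (1 - α) * (2 * Real.log (p.1 : ℝ) / (B p.2) ^ 2) + r p))
        subexpRegime (𝓝 0) := by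
  have hα' : 0 < 1 - α := by linarith [hα.2]
  have hc := gaussianTailConst_pos
  set C := 3 + 3 / gaussianTailConst with hC
  have hC0 : 0 < C := by positivity
  have hBpos : ∀ d, 1 ≤ d → 0 < B d := fun d hd =>
    lt_of_lt_of_le (mul_pos hσ (Real.sqrt_pos.2 (by exact_mod_cast hd))) (hB d hd)
  -- The defect of the expansion without the error term.
  set R : ℕ × ℕ → ℝ := fun p => (M p.2).gap α p.1 + (B p.2) ^ 2 / 2 *
    (1 - 2 * (√(2 * Real.log (p.1 : ℝ)) / B p.2)
      + 1 / (1 - α) * (2 * Real.log (p.1 : ℝ) / (B p.2) ^ 2)) with hR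
  have hev_d : ∀ᶠ p in subexpRegime, 1 ≤ p.2 :=
    Eventually.filter_mono inf_le_left (tendsto_snd.eventually (eventually_ge_atTop 1))
  have hev_N : ∀ᶠ p in subexpRegime, 8 ≤ Real.log (p.1 : ℝ) :=
    Eventually.filter_mono inf_le_left (tendsto_fst.eventually
      ((Real.tendsto_log_atTop.comp tendsto_natCast_atTop_atTop).eventually_ge_atTop 8))
  -- This threshold is exactly what puts the scale `(1-α) B` above `√(2 log N)`, as the upper bound
  -- requires.
  have hev_ratio : ∀ᶠ p in subexpRegime,
      Real.log (p.1 : ℝ) / (p.2 : ℝ) < ((1 - α) * σ_min) ^ 2 / 2 :=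
    Eventually.filter_mono inf_le_right (tendsto_comap.eventually
      (eventually_lt_nhds (by positivity)))
  have hbound : ∀ᶠ p in subexpRegime,
      |R p| ≤ C * (B p.2 * (Real.log (Real.log (p.1 : ℝ)) / √(Real.log (p.1 : ℝ)))) := by
    filter_upwards [hev_d, hev_N, hev_ratio] with ⟨N, d⟩ hd hN hr
    simp only at hd hN hr
    have hb0 := hBpos d hd
    have hd0 : (0 : ℝ) < d := by exact_mod_cast hd
    have hN2 : 2 ≤ N := by
      by_contra h
      have : N = 0 ∨ N = 1 := by omega
      rcases this with rfl | rfl <;> norm_num at hN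
    have hN1 : 1 ≤ N := by omega
    have : Nontrivial (Fin N) := Fin.nontrivial_iff_two_le.2 hN2
    have hX : ∀ i, HasLaw (fun z => -S N d i z) (gaussianReal 0 1) ((M d).sampleMeasure N) :=
      fun i => by
        have h := gaussianReal_neg (hS_law N d hN1 hd i)
        rwa [neg_zero] at h
    have hind : iIndepFun (fun i z => -S N d i z) ((M d).sampleMeasure N) :=
      (hS_indep N d hN1 hd).comp (fun _ x => -x) fun _ => measurable_neg
    have hscale : √(2 * Real.log N) ≤ (1 - α) * B d := by
      rw [div_lt_iff₀ hd0] at hr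
      calc √(2 * Real.log N) ≤ √(((1 - α) * σ_min) ^ 2 * d) := Real.sqrt_le_sqrt (by linarith)
        _ = (1 - α) * (σ_min * √d) := by
          rw [Real.sqrt_mul (by positivity), Real.sqrt_sq (by positivity)]; ring
        _ ≤ _ := mul_le_mul_of_nonneg_left (hB d hd) hα'.le
    have hup := integral_log_sum_exp_le hX (by simpa using hscale)
    have hlo := integral_log_sum_exp_ge hX hind (mul_pos hα' hb0).le (by simpa using hN)
    rw [Fintype.card_fin] at hup hlo
    have hRval : R (N, d) = 1 / (1 - α) * (∫ z, Real.log (∑ i,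
        Real.exp ((1 - α) * B d * -S N d i z)) ∂((M d).sampleMeasure N)) -
          B d * √(2 * Real.log N) := by
      simp only [hR]
      rw [(M d).gap_eq_of_lognormal hN1 hb0.ne' hα.2 (hS_law N d hN1 hd) (hw N d hN1 hd)]
      field_simp
      ring
    rw [hRval, abs_le]
    set G := ∫ z, Real.log (∑ i, Real.exp ((1 - α) * B d * -S N d i z)) ∂((M d).sampleMeasure N)
    have hGa : 1 / (1 - α) * G = G / (1 - α) := by ring
    have hl0 : 0 ≤ Real.log (Real.log N) := Real.log_nonneg (by linarith)
    rw [hGa]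
    constructor
    · have : B d * (√(2 * Real.log N) - C * (Real.log (Real.log N) / √(Real.log N))) ≤
          G / (1 - α) := by
        rw [le_div_iff₀ hα']; linarith
      linarith
    · have : G / (1 - α) ≤ B d * √(2 * Real.log N) := by
        rw [div_le_iff₀ hα']; linarith
      have : 0 ≤ C * (B d * (Real.log (Real.log N) / √(Real.log N))) := by positivity
      linarith
  -- Solving for `r` makes the expression zero whenever `d ≥ 1`; all the content lies in the size of
  -- `R`.
  refine ⟨fun p => -(2 / (B p.2) ^ 2 * R p), ?_, ?_⟩
  · refine IsBigO.of_bound (2 * C) ?_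
    filter_upwards [hbound, hev_d, hev_N] with p hp hd hN
    have hb0 := hBpos p.2 hd
    have hl0 : 0 ≤ Real.log (Real.log p.1) := Real.log_nonneg (by linarith)
    have h1 : 0 ≤ 2 / (B p.2) ^ 2 := by positivity
    have h2 : 0 ≤ Real.log (Real.log (p.1 : ℝ)) / (B p.2 * √(Real.log (p.1 : ℝ))) := by positivity
    rw [norm_neg, norm_mul, Real.norm_of_nonneg h1, Real.norm_of_nonneg h2, Real.norm_eq_abs]
    calc _ ≤ 2 / (B p.2) ^ 2 *
          (C * (B p.2 * (Real.log (Real.log (p.1 : ℝ)) / √(Real.log (p.1 : ℝ))))) := by gcongr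
      _ = _ := by field_simp
  · refine (tendsto_const_nhds (x := (0 : ℝ))).congr' ?_
    filter_upwards [hev_d] with p hd
    have hb0 := hBpos p.2 hd
    simp only [hR]
    field_simp
    ring
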